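/- Let $f:\mathbb{C}\to\mathbb{C}$ be a transcendental entire function, i.e. a holomorphic function on $\mathbb{C}$ that is not a polynomial. Call a family $\mathcal{H}$ of holomorphic functions on a domain $U\subset\mathbb{C}$ normal if every sequence in $\mathcal{H}$ has a subsequence that, locally uniformly on $U$, either converges to a holomorphic function or tends to $\infty$. Let the Fatou set $\mathcal{F}_f$ be the set of points of $\mathbb{C}$ that have a connected open neighbourhood on which the iterates $\{f^{\circ n}\}_{n\ge 0}$ form a normal family, and let the Julia set be $\mathcal{J}_f=\mathbb{C}\setminus\mathcal{F}_f$. Then $\mathcal{J}_f$ is infinite and perfect: it is a closed subset of $\mathbb{C}$, and every point of $\mathcal{J}_f$ is a limit of other points of $\mathcal{J}_f$. -/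

import Mathlib

open Filter Topology

/-- `f : ℂ → ℂ` is a transcendental entire function: holomorphic on all of `ℂ` and not a polynomial. -/
def IsTranscendentalEntire (f : ℂ → ℂ) : Prop :=
  Differentiable ℂ f ∧ ¬ ∃ p : Polynomial ℂ, ∀ z, f z = p.eval z

/-- The sequence `F` tends to `∞` uniformly on every compact subset of `U`. -/
def TendsToInftyLocallyUniformlyOn (F : ℕ → ℂ → ℂ) (U : Set ℂ) : Prop :=
  ∀ K ⊆ U, IsCompact K → ∀ M : ℝ, ∀ᶠ n in atTop, ∀ z ∈ K, M < ‖F n z‖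

/-- A family `H` of holomorphic functions is normal on the domain `U`: every sequence in `H` has a
subsequence which, locally uniformly on `U`, converges to a holomorphic function or tends to `∞`. -/
def IsNormalOn (H : Set (ℂ → ℂ)) (U : Set ℂ) : Prop :=
  ∀ F : ℕ → ℂ → ℂ, (∀ n, F n ∈ H) → ∃ φ : ℕ → ℕ, StrictMono φ ∧
    ((∃ g : ℂ → ℂ, DifferentiableOn ℂ g U ∧
        TendstoLocallyUniformlyOn (fun n => F (φ n)) g atTop U) ∨
      TendsToInftyLocallyUniformlyOn (fun n => F (φ n)) U)

/-- The Fatou set of `f`: the points that have a connected open neighbourhood on which the iterates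
of `f` form a normal family. -/
def fatouSet (f : ℂ → ℂ) : Set ℂ :=
  {z | ∃ U : Set ℂ, IsOpen U ∧ IsConnected U ∧ z ∈ U ∧
    IsNormalOn (Set.range fun n : ℕ => f^[n]) U}

/-- The Julia set of `f`: the complement of the Fatou set in `ℂ`. -/
def juliaSet (f : ℂ → ℂ) : Set ℂ := (fatouSet f)ᶜ

/-!
Everything rests on functions omitting two values. If `f` omits `0` and `1` on a disc, then
`2 f - 1 = cos (π cos g)` for a holomorphic `g` whose image misses a relatively dense set of points,
so Bloch's theorem bounds the variation of `g`. This is Schottky's theorem, and it yields Montel's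
criterion as well as both theorems of Picard.

A transcendental entire `f` covers, from every large disc about `0`, a circle of at least twice the
radius, so its iterates are unbounded on large circles. If the Julia set were finite, then the Fatou
set would be connected and would contain such circles; since bounds on a normal family propagate
through a domain, no bounded orbit could lie in it, and all periodic points would be Julia points.
Little Picard, applied to `(f (f z) - z) / (f z - z)`, gives a solution of `f (f z) = z`, hence a
Julia point `a`. If it is the only one, it has no preimage but possibly itself, and little Picard
for `(f z - a) / (z - a)` in the variable `log (z - a)` gives a fixed point other than `a`; if there
are two, then great Picard and backward invariance give arbitrarily large Julia points.

Finally, an orbit visits all but finitely many points only finitely often. Near an isolated Julia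
point `p`, the iterates would therefore eventually omit two Julia values not recurring along the
orbit of `p`, and Montel's criterion would put `p` in the Fatou set.
-/

open Complex Metric Set

section Cosine

variable {U : Set ℂ} {f g : ℂ → ℂ} {c : ℂ}

lemma differentiableOn_of_differentiableOn_exp (hg : ContinuousOn g U)
    (h : DifferentiableOn ℂ (fun z => exp (g z)) U) : DifferentiableOn ℂ g U := by
  intro z hz
  have hlog : ∀ᶠ w in 𝓝[U] z, log (exp (g w) / exp (g z)) + g z = g w := by
    have hlim : Tendsto (fun w => (g w - g z).im) (𝓝[U] z) (𝓝 0) := by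
      simpa using! (continuous_im.tendsto _).comp ((hg z hz).sub_const (g z))
    filter_upwards [hlim.eventually (Ioo_mem_nhds (neg_lt_zero.2 Real.pi_pos) Real.pi_pos)]
      with w hw
    rw [← exp_sub, log_exp hw.1 hw.2.le, sub_add_cancel]
  have hdiff : DifferentiableWithinAt ℂ (fun w => log (exp (g w) / exp (g z)) + g z) U z :=
    (((h z hz).div_const _).clog (by simp)).add_const _
  exact hdiff.congr_of_eventuallyEq (hlog.mono fun _ => Eq.symm) (by simp)

lemma exists_differentiableOn_exp_eq (hUo : IsOpen U) (hUc : IsSimplyConnected U)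
    (hf : DifferentiableOn ℂ f U) (hf₀ : ∀ z ∈ U, f z ≠ 0) :
    ∃ g : ℂ → ℂ, DifferentiableOn ℂ g U ∧ ∀ z ∈ U, exp (g z) = f z := by
  obtain ⟨g, hg, hexp⟩ := exists_continuousOn_eqOn_exp_comp hUc hUo hf.continuousOn
    (by rintro ⟨z, hz, h⟩; exact hf₀ z hz h)
  exact ⟨g, differentiableOn_of_differentiableOn_exp hg (hf.congr hexp), hexp⟩

lemma exists_differentiableOn_cos_eq (hUo : IsOpen U) (hUc : IsSimplyConnected U)
    (hf : DifferentiableOn ℂ f U) (hf₁ : ∀ z ∈ U, f z ^ 2 ≠ 1) :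
    ∃ g : ℂ → ℂ, DifferentiableOn ℂ g U ∧ ∀ z ∈ U, cos (g z) = f z := by
  obtain ⟨l, hl, hexpl⟩ := exists_differentiableOn_exp_eq hUo hUc
    (f := fun z => 1 - f z ^ 2) ((hf.pow 2).const_sub 1) fun z hz => sub_ne_zero.2 (hf₁ z hz).symm
  -- `exp (i g) = cos g + i sin g`, where the sine is a square root of `1 - f ^ 2`.
  let s : ℂ → ℂ := fun z => exp (l z / 2)
  have hs : ∀ z ∈ U, s z ^ 2 = 1 - f z ^ 2 := fun z hz => by
    rw [← hexpl z hz, ← exp_nat_mul]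
    push_cast
    rw [mul_div_cancel₀ _ two_ne_zero]
  have hmul : ∀ z ∈ U, (f z + I * s z) * (f z - I * s z) = 1 := fun z hz => by
    linear_combination hs z hz - s z ^ 2 * I_sq
  obtain ⟨k, hk, hexpk⟩ := exists_differentiableOn_exp_eq hUo hUc
    (f := fun z => f z + I * s z) (hf.add ((hl.div_const 2).cexp.const_mul I))
    fun z hz => left_ne_zero_of_mul_eq_one (hmul z hz)
  refine ⟨fun z => -I * k z, hk.const_mul _, fun z hz => ?_⟩
  have hI : -I * k z * I = k z := by linear_combination -k z * I_sq
  rw [cos, neg_mul, hI, exp_neg, hexpk z hz, inv_eq_of_mul_eq_one_right (hmul z hz)]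
  ring

lemma abs_im_le_norm_cos (z : ℂ) : |z.im| ≤ ‖cos z‖ := by
  have hcos : cos z = ⟨Real.cos z.re * Real.cosh z.im, -(Real.sin z.re * Real.sinh z.im)⟩ := by
    rw [cos_eq]
    apply Complex.ext <;> simp [cos_ofReal_re, cosh_ofReal_re, sin_ofReal_re, sinh_ofReal_re]
  have hnorm : ‖cos z‖ ^ 2 = Real.cos z.re ^ 2 + Real.sinh z.im ^ 2 := by
    rw [← normSq_eq_norm_sq, hcos, normSq_mk]
    linear_combination Real.cos z.re ^ 2 * Real.cosh_sq z.im +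
      Real.sinh z.im ^ 2 * Real.sin_sq_add_cos_sq z.re
  calc |z.im| ≤ |Real.sinh z.im| := by
        rw [Real.abs_sinh]
        exact Real.self_le_sinh_iff.2 (abs_nonneg _)
    _ ≤ ‖cos z‖ := abs_le_of_sq_le_sq (by rw [hnorm]; linarith [sq_nonneg (Real.cos z.re)])
        (norm_nonneg _)

lemma norm_cos_le_exp_norm (z : ℂ) : ‖cos z‖ ≤ Real.exp ‖z‖ := by
  have h₁ : ‖exp (z * I)‖ ≤ Real.exp ‖z‖ := by simpa using norm_exp_le_exp_norm (z * I)
  have h₂ : ‖exp (-z * I)‖ ≤ Real.exp ‖z‖ := by simpa using norm_exp_le_exp_norm (-z * I)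
  rw [cos, norm_div, Complex.norm_two]
  linarith [norm_add_le (exp (z * I)) (exp (-z * I))]

lemma exists_int_abs_sub_mul_two_pi_le (x : ℝ) : ∃ k : ℤ, |x - k * (2 * Real.pi)| ≤ Real.pi := by
  refine ⟨round (x / (2 * Real.pi)), ?_⟩
  have hx : x - round (x / (2 * Real.pi)) * (2 * Real.pi) =
      (x / (2 * Real.pi) - round (x / (2 * Real.pi))) * (2 * Real.pi) := by
    field_simp
  rw [hx, abs_mul, abs_of_pos Real.two_pi_pos]
  linarith [mul_le_mul_of_nonneg_right (abs_sub_round (x / (2 * Real.pi))) Real.two_pi_pos.le]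

lemma exists_differentiableOn_cos_eq_norm_le (hUo : IsOpen U) (hUc : IsSimplyConnected U)
    (hf : DifferentiableOn ℂ f U) (hf₁ : ∀ z ∈ U, f z ^ 2 ≠ 1) (hc : c ∈ U) :
    ∃ g : ℂ → ℂ, DifferentiableOn ℂ g U ∧ (∀ z ∈ U, cos (g z) = f z) ∧
      ‖g c‖ ≤ Real.pi + ‖f c‖ := by
  obtain ⟨g, hg, hcos⟩ := exists_differentiableOn_cos_eq hUo hUc hf hf₁
  obtain ⟨k, hk⟩ := exists_int_abs_sub_mul_two_pi_le (g c).re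
  have hcos' : ∀ z ∈ U, cos (g z - k * (2 * Real.pi)) = f z := fun z hz => by
    rw [cos_sub_int_mul_two_pi, hcos z hz]
  refine ⟨fun z => g z - k * (2 * Real.pi), hg.sub_const _, hcos', ?_⟩
  calc ‖g c - k * (2 * Real.pi)‖
      ≤ |(g c - k * (2 * Real.pi)).re| + |(g c - k * (2 * Real.pi)).im| :=
        norm_le_abs_re_add_abs_im _
    _ ≤ Real.pi + ‖f c‖ := by
        refine add_le_add (by simpa using hk) ?_
        simpa only [hcos' c hc] using abs_im_le_norm_cos (g c - k * (2 * Real.pi))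

lemma exists_int_eq_cosh_of_nonneg {y : ℝ} (hy : 0 ≤ y) :
    ∃ t ∈ Icc y (y + 2), ∃ n : ℤ, Real.cosh t = n := by
  have hgap : Real.cosh y + 1 ≤ Real.cosh (y + 2) := by
    have hsinh : 2 ≤ Real.sinh 2 := Real.self_le_sinh_iff.2 zero_le_two
    have hcosh : 2 ≤ Real.cosh 2 := hsinh.trans (Real.sinh_lt_cosh 2).le
    rw [Real.cosh_add]
    nlinarith [mul_nonneg (Real.sinh_nonneg_iff.2 hy) (zero_le_two.trans hsinh),
      Real.one_le_cosh y]
  obtain ⟨t, ht, hcosh⟩ := intermediate_value_Icc (by linarith : y ≤ y + 2)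
    Real.continuous_cosh.continuousOn (show (⌈Real.cosh y⌉ : ℝ) ∈ _ from
      ⟨Int.le_ceil _, by linarith [Int.ceil_lt_add_one (Real.cosh y)]⟩)
  exact ⟨t, ht, _, hcosh⟩

lemma exists_int_eq_cosh (y : ℝ) : ∃ t : ℝ, |t - y| ≤ 2 ∧ ∃ n : ℤ, Real.cosh t = n := by
  obtain hy | hy := le_total 0 y
  · obtain ⟨t, ht, hn⟩ := exists_int_eq_cosh_of_nonneg hy
    exact ⟨t, abs_le.2 ⟨by linarith [ht.1], by linarith [ht.2]⟩, hn⟩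
  · obtain ⟨t, ht, hn⟩ := exists_int_eq_cosh_of_nonneg (neg_nonneg.2 hy)
    exact ⟨-t, abs_le.2 ⟨by linarith [ht.2], by linarith [ht.1]⟩, by rwa [Real.cosh_neg]⟩

lemma exists_mem_ball_cos_eq_int (w : ℂ) : ∃ v ∈ ball w 6, ∃ n : ℤ, cos v = n := by
  obtain ⟨k, hk⟩ := exists_int_abs_sub_mul_two_pi_le w.re
  obtain ⟨t, ht, n, hn⟩ := exists_int_eq_cosh w.im
  refine ⟨t * I + k * (2 * Real.pi), ?_, n, ?_⟩
  · rw [mem_ball_iff_norm']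
    calc ‖w - (t * I + k * (2 * Real.pi))‖
        ≤ |(w - (t * I + k * (2 * Real.pi))).re| + |(w - (t * I + k * (2 * Real.pi))).im| :=
          norm_le_abs_re_add_abs_im _
      _ ≤ Real.pi + 2 := add_le_add (by simpa using hk) (by simpa [abs_sub_comm] using ht)
      _ < 6 := by linarith [Real.pi_lt_four]
  · rw [cos_add_int_mul_two_pi, cos_mul_I, ← ofReal_cosh, hn, ofReal_intCast]

end Cosine

section Bloch

lemma exists_ball_forall_norm_le_two_mul {X E : Type*} [PseudoMetricSpace X] [ProperSpace X]
    [NormedAddCommGroup E] {g : X → E} {c : X} {R : ℝ} (hR : 0 < R)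
    (hg : ContinuousOn g (closedBall c R)) (hc : g c ≠ 0) :
    ∃ a, ∃ ρ > 0, ball a ρ ⊆ ball c R ∧ (∀ z ∈ ball a ρ, ‖g z‖ ≤ 2 * ‖g a‖) ∧
      R * ‖g c‖ ≤ 2 * (ρ * ‖g a‖) := by
  obtain ⟨a, -, hmax⟩ := (isCompact_closedBall c R).exists_isMaxOn
    ⟨c, mem_closedBall_self hR.le⟩ (f := fun z => (R - dist z c) * ‖g z‖)
    (((continuous_const.sub (continuous_id.dist continuous_const)).continuousOn).mul hg.norm)
  have hac : R * ‖g c‖ ≤ (R - dist a c) * ‖g a‖ := by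
    simpa using hmax (mem_closedBall_self hR.le)
  have hpos : 0 < (R - dist a c) * ‖g a‖ := (mul_pos hR (norm_pos_iff.2 hc)).trans_le hac
  have hρ : 0 < R - dist a c := pos_of_mul_pos_left hpos (norm_nonneg _)
  have hdist : ∀ z ∈ ball a ((R - dist a c) / 2), (R - dist a c) / 2 < R - dist z c :=
    fun z hz => by linarith [dist_triangle z a c, mem_ball.1 hz]
  refine ⟨a, (R - dist a c) / 2, half_pos hρ, fun z hz => ?_, fun z hz => ?_, by linarith⟩
  · exact mem_ball.2 (by linarith [hdist z hz])
  · have hzmax : (R - dist z c) * ‖g z‖ ≤ (R - dist a c) * ‖g a‖ :=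
      hmax (mem_closedBall.2 (by linarith [hdist z hz]))
    have hle := (mul_le_mul_of_nonneg_right (hdist z hz).le (norm_nonneg (g z))).trans hzmax
    exact le_of_mul_le_mul_left (by linarith) hρ

variable {f : ℂ → ℂ} {a c z : ℂ} {r R δ : ℝ}

lemma ball_subset_image_closedBall_of_norm_deriv_sub_le (hr : 0 < r)
    (hf : ∀ z ∈ closedBall a r, DifferentiableAt ℂ f z)
    (hf' : ∀ z ∈ closedBall a r, ‖deriv f z - deriv f a‖ ≤ ‖deriv f a‖ / 2) :
    ball (f a) (‖deriv f a‖ * r / 4) ⊆ f '' closedBall a r := by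
  obtain h₀ | h₀ := eq_or_ne (deriv f a) 0
  · simp [h₀]
  have ha : a ∈ closedBall a r := mem_closedBall_self hr.le
  have hlin : ∀ z ∈ closedBall a r,
      ‖f z - f a - deriv f a * (z - a)‖ ≤ ‖deriv f a‖ / 2 * ‖z - a‖ := fun z hz => by
    have h := (convex_closedBall a r).norm_image_sub_le_of_norm_hasDerivWithin_le
      (f := fun z => f z - deriv f a * z) (f' := fun z => deriv f z - deriv f a)
      (fun w hw => ((hf w hw).hasDerivAt.sub
        (by simpa using (hasDerivAt_id w).const_mul (deriv f a))).hasDerivWithinAt) hf' ha hz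
    convert! h using 2
    ring
  have hsphere : ∀ z ∈ sphere a r, ‖deriv f a‖ * r / 2 ≤ ‖f z - f a‖ := fun z hz => by
    have h := hlin z (sphere_subset_closedBall hz)
    have htri := norm_sub_norm_le (deriv f a * (z - a)) (f z - f a)
    rw [norm_sub_rev (deriv f a * (z - a)), norm_mul, mem_sphere_iff_norm.1 hz] at htri
    rw [mem_sphere_iff_norm.1 hz] at h
    linarith
  have hdiff : DiffContOnCl ℂ f (ball a r) :=
    DifferentiableOn.diffContOnCl_ball (fun z hz => (hf z hz).differentiableWithinAt) subset_rfl
  have hne : ∃ᶠ z in 𝓝 a, f z ≠ f a :=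
    ((hf a ha).hasDerivAt.eventually_ne h₀).frequently.filter_mono nhdsWithin_le_nhds
  convert! hdiff.ball_subset_image_closedBall hr hsphere hne using 2
  ring

lemma ball_subset_image_ball_of_norm_deriv_le (hr : 0 < r) (hf : DifferentiableOn ℂ f (ball a r))
    (hf' : ∀ z ∈ ball a r, ‖deriv f z‖ ≤ 2 * ‖deriv f a‖) :
    ball (f a) (r * ‖deriv f a‖ / 32) ⊆ f '' ball a r := by
  have hsub : closedBall a (r / 8) ⊆ ball a r := closedBall_subset_ball (by linarith)
  have hmaps : MapsTo (deriv f) (ball a r) (closedBall (deriv f a) (4 * ‖deriv f a‖)) :=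
    fun z hz => by
      rw [mem_closedBall_iff_norm]
      linarith [norm_sub_le (deriv f z) (deriv f a), hf' z hz, norm_nonneg (deriv f a)]
  have hschwarz : ∀ z ∈ closedBall a (r / 8), ‖deriv f z - deriv f a‖ ≤ ‖deriv f a‖ / 2 :=
    fun z hz =>
      calc ‖deriv f z - deriv f a‖ = dist (deriv f z) (deriv f a) := (dist_eq_norm _ _).symm
        _ ≤ 4 * ‖deriv f a‖ / r * dist z a :=
          dist_le_div_mul_dist_of_mapsTo_ball (hf.deriv isOpen_ball) hmaps (hsub hz)
        _ ≤ 4 * ‖deriv f a‖ / r * (r / 8) := by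
          gcongr
          exact hz
        _ = ‖deriv f a‖ / 2 := by field_simp; ring
  have himage := ball_subset_image_closedBall_of_norm_deriv_sub_le (by positivity)
    (fun z hz => hf.differentiableAt (isOpen_ball.mem_nhds (hsub hz))) hschwarz
  refine Subset.trans (ball_subset_ball (le_of_eq ?_)) (himage.trans (image_mono hsub))
  ring

theorem exists_ball_subset_image_ball (hR : 0 < R) (hf : DifferentiableOn ℂ f (ball c R)) :
    ∃ b, ball b (R * ‖deriv f c‖ / 128) ⊆ f '' ball c R := by
  obtain h₀ | h₀ := eq_or_ne (deriv f c) 0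
  · exact ⟨0, by simp [h₀]⟩
  have hcont : ContinuousOn (deriv f) (closedBall c (R / 2)) :=
    (hf.deriv isOpen_ball).continuousOn.mono (closedBall_subset_ball (half_lt_self hR))
  obtain ⟨a, ρ, hρ, hsub, hle, hlarge⟩ := exists_ball_forall_norm_le_two_mul (half_pos hR) hcont h₀
  have hsub' : ball a ρ ⊆ ball c R := hsub.trans (ball_subset_ball (half_le_self hR.le))
  exact ⟨f a, (ball_subset_ball (by linarith)).trans
    ((ball_subset_image_ball_of_norm_deriv_le hρ (hf.mono hsub') hle).trans (image_mono hsub'))⟩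

lemma norm_sub_le_of_forall_exists_mem_ball_notMem_image (hR : 0 < R)
    (hf : DifferentiableOn ℂ f (ball c R)) (hδ : ∀ w, ∃ v ∈ ball w δ, v ∉ f '' ball c R)
    (hz : z ∈ closedBall c (R / 2)) : ‖f z - f c‖ ≤ 128 * δ := by
  have hderiv : ∀ w ∈ closedBall c (R / 2), ‖deriv f w‖ ≤ 256 * δ / R := fun w hw => by
    have hsub : ball w (R / 2) ⊆ ball c R := ball_subset_ball' (by linarith [mem_closedBall.1 hw])
    obtain ⟨b, hb⟩ := exists_ball_subset_image_ball (half_pos hR) (hf.mono hsub)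
    obtain ⟨v, hv, hvf⟩ := hδ b
    by_contra! hlt
    rw [div_lt_iff₀ hR] at hlt
    exact hvf (image_mono hsub (hb (ball_subset_ball (by linarith) hv)))
  have hc : c ∈ closedBall c (R / 2) := mem_closedBall_self (half_pos hR).le
  calc ‖f z - f c‖ ≤ 256 * δ / R * ‖z - c‖ :=
        (convex_closedBall c (R / 2)).norm_image_sub_le_of_norm_deriv_le
          (fun w hw => hf.differentiableAt (isOpen_ball.mem_nhds
            (closedBall_subset_ball (half_lt_self hR) hw))) hderiv hc hz
    _ ≤ 256 * δ / R * (R / 2) := mul_le_mul_of_nonneg_left (mem_closedBall_iff_norm.1 hz)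
        ((norm_nonneg _).trans (hderiv c hc))
    _ = 128 * δ := by field_simp; ring

end Bloch

section Schottky

/-- The holomorphic functions on `U` that omit the values `a` and `b`. Values outside `U` are
unconstrained. -/
def holomorphicOmitting (U : Set ℂ) (a b : ℂ) : Set (ℂ → ℂ) :=
  {f | DifferentiableOn ℂ f U ∧ MapsTo f U {a, b}ᶜ}

variable {U V : Set ℂ} {f : ℂ → ℂ} {a b c : ℂ}

lemma holomorphicOmitting_anti (h : V ⊆ U) :
    holomorphicOmitting U a b ⊆ holomorphicOmitting V a b :=
  fun _ hf => ⟨hf.1.mono h, hf.2.mono_left h⟩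

lemma comp_mem_holomorphicOmitting {g : ℂ → ℂ} (hf : f ∈ holomorphicOmitting U a b)
    (hg : DifferentiableOn ℂ g V) (hVU : MapsTo g V U) : f ∘ g ∈ holomorphicOmitting V a b :=
  ⟨hf.1.comp hg hVU, hf.2.comp hVU⟩

lemma sub_div_mem_holomorphicOmitting (hab : a ≠ b) (hf : f ∈ holomorphicOmitting U a b) :
    (fun z => (f z - a) / (b - a)) ∈ holomorphicOmitting U 0 1 := by
  have hba : b - a ≠ 0 := sub_ne_zero.2 hab.symm
  refine ⟨(hf.1.sub_const a).div_const _, fun z hz => ?_⟩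
  have hfz : f z ≠ a ∧ f z ≠ b := by simpa using hf.2 hz
  simp [sub_eq_zero, hba, hfz.1, hfz.2, div_eq_one_iff_eq]

lemma cos_sq_eq_one_of_eq_int_mul_pi {w : ℂ} {n : ℤ} (hw : w = n * Real.pi) : cos w ^ 2 = 1 := by
  rw [← sin_sq_add_cos_sq w, hw, sin_int_mul_pi]
  ring

lemma exists_cos_pi_mul_cos_eq (hUo : IsOpen U) (hUc : IsSimplyConnected U)
    (hf : f ∈ holomorphicOmitting U 0 1) (hc : c ∈ U) :
    ∃ g : ℂ → ℂ, DifferentiableOn ℂ g U ∧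
      (∀ z ∈ U, cos (Real.pi * cos (g z)) = 2 * f z - 1) ∧ (∀ z ∈ U, ∀ n : ℤ, cos (g z) ≠ n) ∧
      ‖g c‖ ≤ 2 * Real.pi + ‖2 * f c - 1‖ := by
  have hpi : (Real.pi : ℂ) ≠ 0 := ofReal_ne_zero.2 Real.pi_ne_zero
  have hne : ∀ z ∈ U, (2 * f z - 1) ^ 2 ≠ 1 := fun z hz h => by
    have hfz : f z ≠ 0 ∧ f z ≠ 1 := by simpa using hf.2 hz
    exact mul_ne_zero hfz.1 (sub_ne_zero.2 hfz.2) (by linear_combination h / 4)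
  obtain ⟨h, hh, hcosh, hhc⟩ := exists_differentiableOn_cos_eq_norm_le hUo hUc
    ((hf.1.const_mul 2).sub_const 1) hne hc
  have hint : ∀ z ∈ U, ∀ n : ℤ, h z / Real.pi ≠ n := fun z hz n hn =>
    hne z hz (hcosh z hz ▸ cos_sq_eq_one_of_eq_int_mul_pi ((div_eq_iff hpi).1 hn))
  have hne' : ∀ z ∈ U, (h z / Real.pi) ^ 2 ≠ 1 := fun z hz hsq =>
    (sq_eq_one_iff.1 hsq).elim (by simpa using hint z hz 1) (by simpa using hint z hz (-1))
  obtain ⟨g, hg, hcosg, hgc⟩ := exists_differentiableOn_cos_eq_norm_le hUo hUc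
    (hh.div_const (Real.pi : ℂ)) hne' hc
  refine ⟨g, hg, fun z hz => ?_, fun z hz => hcosg z hz ▸ hint z hz, ?_⟩
  · rw [hcosg z hz, mul_div_cancel₀ _ hpi, hcosh z hz]
  · have hle : ‖h c / Real.pi‖ ≤ ‖h c‖ := by
      rw [norm_div, norm_real, Real.norm_of_nonneg Real.pi_pos.le]
      exact div_le_self (norm_nonneg _) (by linarith [Real.pi_gt_three])
    linarith

lemma norm_cos_pi_mul_cos_le (w : ℂ) :
    ‖cos (Real.pi * cos w)‖ ≤ Real.exp (Real.pi * Real.exp ‖w‖) := by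
  refine (norm_cos_le_exp_norm _).trans (Real.exp_le_exp.2 ?_)
  rw [norm_mul, norm_real, Real.norm_of_nonneg Real.pi_pos.le]
  exact mul_le_mul_of_nonneg_left (norm_cos_le_exp_norm w) Real.pi_pos.le

lemma exists_forall_norm_le_of_mem_holomorphicOmitting_zero_one (M : ℝ) :
    ∃ M', ∀ c, ∀ R > 0, ∀ f ∈ holomorphicOmitting (ball c R) 0 1, ‖f c‖ ≤ M →
      ∀ z ∈ closedBall c (R / 2), ‖f z‖ ≤ M' := by
  refine ⟨(1 + Real.exp (Real.pi * Real.exp (768 + (2 * Real.pi + (2 * M + 1))))) / 2,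
    fun c R hR f hf hM z hz => ?_⟩
  have hsc : IsSimplyConnected (ball c R) := by
    have := contractibleSpace_ball (x := c) hR
    exact SimplyConnectedSpace.ofContractible _
  obtain ⟨g, hg, hcos, hint, hgc⟩ := exists_cos_pi_mul_cos_eq isOpen_ball hsc hf (mem_ball_self hR)
  have hosc : ‖g z - g c‖ ≤ 768 := by
    have h := norm_sub_le_of_forall_exists_mem_ball_notMem_image (δ := 6) hR hg (fun w => ?_) hz
    · linarith
    · obtain ⟨v, hv, n, hn⟩ := exists_mem_ball_cos_eq_int w
      exact ⟨v, hv, by rintro ⟨x, hx, rfl⟩; exact hint x hx n hn⟩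
  have hfc : ‖2 * f c - 1‖ ≤ 2 * M + 1 := (norm_sub_le _ _).trans (by simpa using hM)
  have hgz : ‖g z‖ ≤ 768 + (2 * Real.pi + (2 * M + 1)) := by
    linarith [norm_le_norm_add_norm_sub' (g z) (g c)]
  have hfz : ‖2 * f z - 1‖ ≤
      Real.exp (Real.pi * Real.exp (768 + (2 * Real.pi + (2 * M + 1)))) := by
    rw [← hcos z (closedBall_subset_ball (half_lt_self hR) hz)]
    exact (norm_cos_pi_mul_cos_le _).trans (by gcongr)
  have h2f : 2 * ‖f z‖ ≤ 1 + ‖2 * f z - 1‖ := by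
    simpa using norm_add_le 1 (2 * f z - 1)
  linarith

theorem exists_forall_norm_le_of_mem_holomorphicOmitting_ball (hab : a ≠ b) (M : ℝ) :
    ∃ M', ∀ c, ∀ R > 0, ∀ f ∈ holomorphicOmitting (ball c R) a b, ‖f c‖ ≤ M →
      ∀ z ∈ closedBall c (R / 2), ‖f z‖ ≤ M' := by
  obtain ⟨M', hM'⟩ :=
    exists_forall_norm_le_of_mem_holomorphicOmitting_zero_one ((M + ‖a‖) / ‖b - a‖)
  refine ⟨‖a‖ + M' * ‖b - a‖, fun c R hR f hf hM z hz => ?_⟩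
  have hba : 0 < ‖b - a‖ := norm_pos_iff.2 (sub_ne_zero.2 hab.symm)
  have hfc : ‖(f c - a) / (b - a)‖ ≤ (M + ‖a‖) / ‖b - a‖ := by
    rw [norm_div]
    gcongr
    exact (norm_sub_le _ _).trans (by gcongr)
  have hfz := hM' c R hR _ (sub_div_mem_holomorphicOmitting hab hf) hfc z hz
  rw [norm_div, div_le_iff₀ hba] at hfz
  linarith [norm_le_norm_add_norm_sub' (f z) a]

end Schottky

section BoundPropagation

variable {X E : Type*} [Norm E] {H : Set (X → E)} {s s' t t' : Set X}

/-- A bound for a function of the family `H` at some point of `s` propagates to a bound on `t` that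
is uniform over `H`. This is the qualitative content of Schottky's theorem. -/
def BoundPropagates (H : Set (X → E)) (s t : Set X) : Prop :=
  ∀ M : ℝ, ∃ M' : ℝ, ∀ f ∈ H, ∀ z ∈ s, ‖f z‖ ≤ M → ∀ w ∈ t, ‖f w‖ ≤ M'

namespace BoundPropagates

lemma mono (h : BoundPropagates H s t) (hs : s' ⊆ s) (ht : t' ⊆ t) : BoundPropagates H s' t' :=
  fun M => (h M).imp fun _ hM' f hf z hz hzM w hw => hM' f hf z (hs hz) hzM w (ht hw)

lemma trans {u : Set X} (hst : BoundPropagates H s t) (ht : t.Nonempty)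
    (htu : BoundPropagates H t u) : BoundPropagates H s u := by
  intro M
  obtain ⟨w, hw⟩ := ht
  obtain ⟨M', hM'⟩ := hst M
  exact (htu M').imp fun _ hM'' f hf z hz hzM => hM'' f hf w hw (hM' f hf z hz hzM w hw)

lemma union_left (h : BoundPropagates H s t) (h' : BoundPropagates H s' t) :
    BoundPropagates H (s ∪ s') t := by
  intro M
  obtain ⟨M₁, hM₁⟩ := h M
  obtain ⟨M₂, hM₂⟩ := h' M
  refine ⟨max M₁ M₂, fun f hf z hz hzM w hw => ?_⟩
  exact hz.elim (fun hz => (hM₁ f hf z hz hzM w hw).trans (le_max_left _ _))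
    fun hz => (hM₂ f hf z hz hzM w hw).trans (le_max_right _ _)

lemma union_right (h : BoundPropagates H s t) (h' : BoundPropagates H s t') :
    BoundPropagates H s (t ∪ t') := by
  intro M
  obtain ⟨M₁, hM₁⟩ := h M
  obtain ⟨M₂, hM₂⟩ := h' M
  refine ⟨max M₁ M₂, fun f hf z hz hzM w hw => ?_⟩
  exact hw.elim (fun hw => (hM₁ f hf z hz hzM w hw).trans (le_max_left _ _))
    fun hw => (hM₂ f hf z hz hzM w hw).trans (le_max_right _ _)

variable [TopologicalSpace X] {U K L : Set X} {x y : X}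

lemma exists_nhdsWithin_of_isPreconnected (hU : IsPreconnected U)
    (h : ∀ x ∈ U, ∃ V ∈ 𝓝[U] x, BoundPropagates H V V) (hx : x ∈ U) (hy : y ∈ U) :
    ∃ V ∈ 𝓝[U] x, ∃ W ∈ 𝓝[U] y, BoundPropagates H V W := by
  refine hU.induction₂' (fun x y => ∃ V ∈ 𝓝[U] x, ∃ W ∈ 𝓝[U] y, BoundPropagates H V W)
    (fun x hx => ?_) (fun x y z _ hy _ => ?_) hx hy
  · obtain ⟨V, hV, hVV⟩ := h x hx
    filter_upwards [eventually_eventually_nhdsWithin.2 hV] with y hy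
    exact ⟨⟨V, hV, V, hy, hVV⟩, ⟨V, hy, V, hV, hVV⟩⟩
  · rintro ⟨V, hV, W, hW, hVW⟩ ⟨W', hW', Z, hZ, hWZ⟩
    exact ⟨V, hV, Z, hZ, (hVW.mono subset_rfl inter_subset_left).trans
      ⟨y, mem_of_mem_nhdsWithin hy hW, mem_of_mem_nhdsWithin hy hW'⟩
      (hWZ.mono inter_subset_right subset_rfl)⟩

lemma of_isCompact_of_isPreconnected (hU : IsPreconnected U)
    (h : ∀ x ∈ U, ∃ V ∈ 𝓝[U] x, BoundPropagates H V V) (hK : IsCompact K) (hKU : K ⊆ U)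
    (hL : IsCompact L) (hLU : L ⊆ U) : BoundPropagates H K L := by
  have hnhds : ∀ x ∈ U, ∃ V ∈ 𝓝[U] x, BoundPropagates H V L := fun x hx => by
    refine hL.induction_on ⟨univ, univ_mem, fun M => ⟨0, by simp⟩⟩
      (fun s t hst ⟨V, hV, hVt⟩ => ⟨V, hV, hVt.mono subset_rfl hst⟩)
      (fun s t ⟨V, hV, hVs⟩ ⟨W, hW, hWt⟩ => ⟨V ∩ W, inter_mem hV hW,
        (hVs.mono inter_subset_left subset_rfl).union_right
          (hWt.mono inter_subset_right subset_rfl)⟩) fun y hy => ?_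
    obtain ⟨V, hV, W, hW, hVW⟩ := exists_nhdsWithin_of_isPreconnected hU h hx (hLU hy)
    exact ⟨W, nhdsWithin_mono y hLU hW, V, hV, hVW⟩
  refine hK.induction_on (fun M => ⟨0, by simp⟩) (fun s t hst ht => ht.mono hst subset_rfl)
    (fun s t => union_left) fun x hx => ?_
  obtain ⟨V, hV, hVL⟩ := hnhds x (hKU hx)
  exact ⟨V, nhdsWithin_mono x hKU hV, hVL⟩

end BoundPropagates

end BoundPropagation

section Montel

theorem boundPropagates_holomorphicOmitting {U K L : Set ℂ} {a b : ℂ} (hab : a ≠ b)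
    (hUo : IsOpen U) (hUc : IsPreconnected U) (hK : IsCompact K) (hKU : K ⊆ U) (hL : IsCompact L)
    (hLU : L ⊆ U) : BoundPropagates (holomorphicOmitting U a b) K L := by
  refine .of_isCompact_of_isPreconnected hUc (fun x hx => ?_) hK hKU hL hLU
  obtain ⟨R, hR, hball⟩ := Metric.isOpen_iff.1 hUo x hx
  refine ⟨ball x (R / 8), mem_nhdsWithin_of_mem_nhds (ball_mem_nhds x (by positivity)), fun M => ?_⟩
  refine (exists_forall_norm_le_of_mem_holomorphicOmitting_ball hab M).imp
    fun M' hM' f hf z hz hzM w hw => ?_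
  rw [mem_ball] at hz hw
  have hsub : ball z (R / 2) ⊆ U := (ball_subset_ball' (by linarith)).trans hball
  refine hM' z (R / 2) (half_pos hR) f (holomorphicOmitting_anti hsub hf) hzM w ?_
  exact mem_closedBall.2 (by linarith [dist_triangle_right w z x])

lemma exists_subseq_tendstoLocallyUniformly {X E : Type*} [TopologicalSpace X]
    [WeaklyLocallyCompactSpace X] [SigmaCompactSpace X] [MetricSpace E] [ProperSpace E]
    {F : ℕ → X → E} (hF : Equicontinuous F)
    (hbdd : ∀ x, Bornology.IsBounded (range fun n => F n x)) :
    ∃ φ : ℕ → ℕ, StrictMono φ ∧ ∃ g, TendstoLocallyUniformly (fun n => F (φ n)) g atTop := by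
  let G : ℕ → C(X, E) := fun n => ⟨F n, hF.continuous n⟩
  have hemb : IsClosedEmbedding
      (UniformOnFun.ofFun {K : Set X | IsCompact K} ∘ ((↑) : C(X, E) → X → E)) := by
    have := UniformOnFun.t2Space_of_covering (β := E) (𝔖 := {K : Set X | IsCompact K})
      (sUnion_eq_univ_iff.2 fun x => ⟨{x}, isCompact_singleton, rfl⟩)
    exact ContinuousMap.isUniformEmbedding_toUniformOnFunIsCompact.isClosedEmbedding
  have hcompact : IsCompact (closure (range G)) := by
    refine ArzelaAscoli.isCompact_closure_of_isClosedEmbedding (fun _ => id) hemb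
      (fun K _ => ?_) fun K _ x _ => ⟨_, (hbdd x).isCompact_closure, ?_⟩
    · refine Equicontinuous.equicontinuousOn (equicontinuous_iff_range.2 ?_) K
      have hrange : range (((↑) : C(X, E) → X → E) ∘ ((↑) : range G → C(X, E))) = range F := by
        rw [range_comp, Subtype.range_coe, ← range_comp]
        rfl
      exact hrange ▸ equicontinuous_iff_range.1 hF
    · rintro _ ⟨n, rfl⟩
      exact subset_closure (mem_range_self n)
  obtain ⟨g, -, φ, hφ, hlim⟩ := hcompact.tendsto_subseq fun n => subset_closure (mem_range_self n)
  exact ⟨φ, hφ, g, ContinuousMap.tendsto_iff_tendstoLocallyUniformly.1 hlim⟩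

lemma equicontinuousAt_of_forall_norm_le {ι E : Type*} [NormedAddCommGroup E] [NormedSpace ℂ E]
    {F : ι → ℂ → E} {c : ℂ} {r M : ℝ} (hr : 0 < r) (hF : ∀ i, DifferentiableOn ℂ (F i) (ball c r))
    (hM : ∀ i, ∀ z ∈ ball c r, ‖F i z‖ ≤ M) : EquicontinuousAt F c := by
  refine equicontinuousAt_of_continuity_modulus (fun z => (M + M) / r * dist z c) ?_ F ?_
  · exact Continuous.tendsto' (by fun_prop) _ _ (by simp)
  · filter_upwards [ball_mem_nhds c hr] with z hz i
    rw [dist_comm]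
    refine dist_le_div_mul_dist_of_mapsTo_ball (hF i) (fun w hw => ?_) hz
    rw [mem_closedBall_iff_norm]
    exact (norm_sub_le _ _).trans (add_le_add (hM i w hw) (hM i c (mem_ball_self hr)))

theorem exists_subseq_tendstoLocallyUniformlyOn {U : Set ℂ} (hU : IsOpen U) {F : ℕ → ℂ → ℂ}
    (hF : ∀ n, DifferentiableOn ℂ (F n) U)
    (hbdd : ∀ K ⊆ U, IsCompact K → ∃ M, ∀ n, ∀ z ∈ K, ‖F n z‖ ≤ M) :
    ∃ φ : ℕ → ℕ, StrictMono φ ∧ ∃ g, DifferentiableOn ℂ g U ∧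
      TendstoLocallyUniformlyOn (fun n => F (φ n)) g atTop U := by
  have := hU.locallyCompactSpace
  have hequi : EquicontinuousOn F U := fun z hz => by
    obtain ⟨r, hr, hsub⟩ := nhds_basis_closedBall.mem_iff.1 (hU.mem_nhds hz)
    obtain ⟨M, hM⟩ := hbdd _ hsub (isCompact_closedBall z r)
    exact (equicontinuousAt_of_forall_norm_le hr
      (fun n => (hF n).mono (ball_subset_closedBall.trans hsub))
      fun n w hw => hM n w (ball_subset_closedBall hw)).equicontinuousWithinAt U
  obtain ⟨φ, hφ, g, hg⟩ := exists_subseq_tendstoLocallyUniformly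
    ((equicontinuous_restrict_iff F).2 hequi) fun z => by
      obtain ⟨M, hM⟩ := hbdd {↑z} (singleton_subset_iff.2 z.2) isCompact_singleton
      exact isBounded_iff_forall_norm_le.2 ⟨M, forall_mem_range.2 fun n => hM n z rfl⟩
  have hlim : TendstoLocallyUniformlyOn (fun n => F (φ n)) (Function.extend (↑) g 0) atTop U := by
    rw [tendstoLocallyUniformlyOn_iff_tendstoLocallyUniformly_comp_coe]
    convert! hg using 1
    exact funext fun z => Subtype.val_injective.extend_apply g 0 z
  exact ⟨φ, hφ, _, hlim.differentiableOn (.of_forall fun n => hF _) hU, hlim⟩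

theorem isNormalOn_holomorphicOmitting {U : Set ℂ} {a b : ℂ} (hab : a ≠ b) (hUo : IsOpen U)
    (hUc : IsConnected U) : IsNormalOn (holomorphicOmitting U a b) U := by
  intro F hF
  obtain ⟨z₀, hz₀⟩ := hUc.nonempty
  have hschottky : ∀ K ⊆ U, IsCompact K → ∀ L ⊆ U, IsCompact L →
      BoundPropagates (holomorphicOmitting U a b) K L := fun K hKU hK L hLU hL =>
    boundPropagates_holomorphicOmitting hab hUo hUc.isPreconnected hK hKU hL hLU
  have hz₀U : {z₀} ⊆ U := singleton_subset_iff.2 hz₀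
  by_cases hbdd : ∃ M, ∃ᶠ n in atTop, ‖F n z₀‖ ≤ M
  · obtain ⟨M, hM⟩ := hbdd
    obtain ⟨ψ, hψ, hψM⟩ := extraction_of_frequently_atTop hM
    obtain ⟨φ, hφ, hlim⟩ := exists_subseq_tendstoLocallyUniformlyOn (F := fun n => F (ψ n)) hUo
      (fun n => (hF _).1) fun K hKU hK =>
        (hschottky {z₀} hz₀U isCompact_singleton K hKU hK M).imp
          fun M' hM' n => hM' _ (hF _) z₀ rfl (hψM n)
    exact ⟨ψ ∘ φ, hψ.comp hφ, Or.inl hlim⟩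
  · push Not at hbdd
    refine ⟨id, strictMono_id, Or.inr fun K hKU hK M => ?_⟩
    obtain ⟨M', hM'⟩ := hschottky K hKU hK {z₀} hz₀U isCompact_singleton M
    filter_upwards [hbdd M'] with n hn z hz
    exact lt_of_not_ge fun hle => hn.not_ge (hM' _ (hF n) z hz hle z₀ rfl)

end Montel

section Picard

variable {C : ℝ} {m : ℕ}

lemma iteratedDeriv_eq_zero_of_frequently_norm_le {E : Type*} [NormedAddCommGroup E]
    [NormedSpace ℂ E] [CompleteSpace E] {f : ℂ → E} (hf : Differentiable ℂ f)
    (h : ∃ᶠ r in atTop, ∀ z ∈ sphere (0 : ℂ) r, ‖f z‖ ≤ C * r ^ m) {n : ℕ} (hmn : m < n) :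
    iteratedDeriv n f 0 = 0 := by
  have hlim : Tendsto (fun r : ℝ => n.factorial * (C * (r ^ m / r ^ n))) atTop (𝓝 0) := by
    simpa using ((tendsto_pow_div_pow_atTop_zero hmn).const_mul C).const_mul (n.factorial : ℝ)
  refine norm_le_zero_iff.1 (ge_of_tendsto_of_frequently hlim ?_)
  refine (h.and_eventually (eventually_gt_atTop 0)).mono fun r ⟨hr, hr₀⟩ => ?_
  convert! norm_iteratedDeriv_le_of_forall_mem_sphere_norm_le n hr₀ hf.diffContOnCl hr using 1
  ring

variable {f : ℂ → ℂ} {a b : ℂ}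

theorem exists_polynomial_of_frequently_norm_le (hf : Differentiable ℂ f)
    (h : ∃ᶠ r in atTop, ∀ z ∈ sphere (0 : ℂ) r, ‖f z‖ ≤ C * r ^ m) :
    ∃ p : Polynomial ℂ, ∀ z, f z = p.eval z := by
  refine ⟨∑ n ∈ Finset.range (m + 1),
    Polynomial.C ((n.factorial : ℂ)⁻¹ * iteratedDeriv n f 0) * Polynomial.X ^ n, fun z => ?_⟩
  rw [← taylorSeries_eq_of_entire' 0 z hf, tsum_eq_sum (s := Finset.range (m + 1)) fun n hn => ?_]
  · simp [Polynomial.eval_finsetSum]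
  · rw [iteratedDeriv_eq_zero_of_frequently_norm_le hf h (by simpa using hn)]
    simp

theorem exists_polynomial_of_meromorphicAt_inv (hf : Differentiable ℂ f)
    (h : MeromorphicAt (fun w => f w⁻¹) 0) : ∃ p : Polynomial ℂ, ∀ z, f z = p.eval z := by
  obtain ⟨n, hn⟩ := h
  obtain ⟨C, hC⟩ := hn.continuousAt.norm.isBoundedUnder_le
  have hgrowth : ∀ᶠ z in Bornology.cobounded ℂ, ‖f z‖ ≤ C * ‖z‖ ^ n := by
    filter_upwards [tendsto_inv₀_cobounded.eventually (eventually_map.1 hC),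
      Bornology.eventually_ne_cobounded 0] with z hz hz₀
    rw [sub_zero, inv_inv, norm_smul, norm_pow, norm_inv, inv_pow, inv_mul_le_iff₀
      (by positivity)] at hz
    linarith
  rw [← comap_norm_atTop, eventually_comap] at hgrowth
  refine exists_polynomial_of_frequently_norm_le (C := C) (m := n) hf (hgrowth.frequently.mono ?_)
  intro r hr z hz
  rw [← mem_sphere_zero_iff_norm.1 hz]
  exact hr z (mem_sphere_zero_iff_norm.1 hz)

theorem exists_polynomial_of_tendsto_cobounded (hf : Differentiable ℂ f)
    (h : Tendsto f (Bornology.cobounded ℂ) (Bornology.cobounded ℂ)) :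
    ∃ p : Polynomial ℂ, ∀ z, f z = p.eval z := by
  have hlim : Tendsto (fun w => f w⁻¹) (𝓝[≠] 0) (Bornology.cobounded ℂ) :=
    h.comp tendsto_inv₀_nhdsNE_zero
  let g : ℂ → ℂ := Function.update (fun w => (f w⁻¹)⁻¹) 0 0
  have hg : ∀ᶠ w in 𝓝[≠] 0, (f w⁻¹)⁻¹ = g w := by
    filter_upwards [self_mem_nhdsWithin] with w hw
    exact (Function.update_of_ne hw _ (fun w => (f w⁻¹)⁻¹)).symm
  have hanalytic : AnalyticAt ℂ g 0 := by
    refine analyticAt_of_differentiable_on_punctured_nhds_of_continuousAt ?_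
      (continuousAt_update_same.2 (tendsto_inv₀_cobounded.comp hlim))
    filter_upwards [self_mem_nhdsWithin, hlim.eventually (Bornology.eventually_ne_cobounded 0),
      eventually_eventually_nhdsWithin.2 hg] with w hw₀ hfw hgw
    rw [IsOpen.nhdsWithin_eq isOpen_compl_singleton hw₀] at hgw
    exact ((hf.differentiableAt.comp w (differentiableAt_inv hw₀)).inv hfw).congr_of_eventuallyEq
      (hgw.mono fun _ => Eq.symm)
  refine exists_polynomial_of_meromorphicAt_inv hf (hanalytic.meromorphicAt.inv.congr ?_)
  filter_upwards [hg] with w hw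
  rw [Pi.inv_apply, ← hw, inv_inv]

theorem eq_of_mem_holomorphicOmitting_univ (hab : a ≠ b) (hf : f ∈ holomorphicOmitting univ a b)
    (z w : ℂ) : f z = f w := by
  obtain ⟨M, hM⟩ := exists_forall_norm_le_of_mem_holomorphicOmitting_ball hab ‖f 0‖
  refine (differentiableOn_univ.1 hf.1).apply_eq_apply_of_bounded
    (isBounded_iff_forall_norm_le.2 ⟨M, forall_mem_range.2 fun z => ?_⟩) z w
  exact hM 0 (2 * (‖z‖ + 1)) (by positivity) f (holomorphicOmitting_anti (subset_univ _) hf)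
    le_rfl z (mem_closedBall_zero_iff.2 (by linarith))

lemma exists_forall_norm_le_on_sphere (hab : a ≠ b) (M : ℝ) :
    ∃ M', ∀ f z₁, z₁ ≠ 0 →
      f ∈ holomorphicOmitting (closedBall 0 (Real.exp (-(2 * Real.pi)) * ‖z₁‖))ᶜ a b →
      ‖f z₁‖ ≤ M → ∀ z ∈ sphere 0 ‖z₁‖, ‖f z‖ ≤ M' := by
  refine (exists_forall_norm_le_of_mem_holomorphicOmitting_ball hab M).imp
    fun M' hM' f z₁ hz₁ hf hM z hz => ?_
  have hcomp : f ∘ (fun ζ => z₁ * exp ζ) ∈ holomorphicOmitting (ball 0 (2 * Real.pi)) a b := by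
    refine comp_mem_holomorphicOmitting hf (by fun_prop) fun ζ hζ => ?_
    rw [mem_compl_iff, mem_closedBall_zero_iff, not_le, norm_mul, norm_exp, mul_comm]
    have hre : -(2 * Real.pi) < ζ.re :=
      neg_lt.1 ((neg_re ζ ▸ re_le_norm (-ζ)).trans_lt (by simpa using hζ))
    gcongr
  have hpolar : z₁ * exp (arg (z / z₁) * I) = z := by
    have hnorm : ‖z / z₁‖ = 1 := by
      rw [norm_div, mem_sphere_zero_iff_norm.1 hz, div_self (norm_ne_zero_iff.2 hz₁)]
    have h := norm_mul_exp_arg_mul_I (z / z₁)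
    rw [hnorm, ofReal_one, one_mul] at h
    rw [h, mul_div_cancel₀ _ hz₁]
  have hbound := hM' 0 (2 * Real.pi) Real.two_pi_pos _ hcomp (by simpa using hM)
    (arg (z / z₁) * I) (by simpa using abs_arg_le_pi (z / z₁))
  rwa [Function.comp_apply, hpolar] at hbound

theorem exists_polynomial_of_eventually_notMem (hab : a ≠ b) (hf : Differentiable ℂ f)
    (h : ∀ᶠ z in Bornology.cobounded ℂ, f z ∉ ({a, b} : Set ℂ)) :
    ∃ p : Polynomial ℂ, ∀ z, f z = p.eval z := by
  by_cases hlim : Tendsto f (Bornology.cobounded ℂ) (Bornology.cobounded ℂ)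
  · exact exists_polynomial_of_tendsto_cobounded hf hlim
  obtain ⟨M, hM⟩ : ∃ M, ∃ᶠ z in Bornology.cobounded ℂ, ¬M ≤ ‖f z‖ := by
    rw [← tendsto_norm_atTop_iff_cobounded, Filter.tendsto_atTop] at hlim
    simpa only [not_forall, not_eventually] using hlim
  obtain ⟨M', hM'⟩ := exists_forall_norm_le_on_sphere hab M
  obtain ⟨R, -, hR⟩ := (hasBasis_cobounded_compl_closedBall (0 : ℂ)).eventually_iff.1 h
  refine exists_polynomial_of_frequently_norm_le (C := M') (m := 0) hf
    ((tendsto_norm_cobounded_atTop (E := ℂ)).frequently ?_)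
  have hlarge : ∀ᶠ z : ℂ in Bornology.cobounded ℂ, R ≤ Real.exp (-(2 * Real.pi)) * ‖z‖ :=
    (tendsto_norm_cobounded_atTop.const_mul_atTop (Real.exp_pos _)).eventually_ge_atTop R
  refine (hM.and_eventually (hlarge.and (Bornology.eventually_ne_cobounded 0))).mono
    fun z₁ ⟨hz₁, hRz₁, hz₁₀⟩ z hz => ?_
  rw [pow_zero, mul_one]
  exact hM' f z₁ hz₁₀ ⟨hf.differentiableOn,
    fun w hw => hR (compl_subset_compl.2 (closedBall_subset_closedBall hRz₁) hw)⟩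
    (not_le.1 hz₁).le z hz

end Picard

section Normal

variable {H H' S : Set (ℂ → ℂ)} {U : Set ℂ} {F : ℕ → ℂ → ℂ} {g h : ℂ → ℂ}

lemma IsNormalOn.mono (hH : IsNormalOn H U) (h : H' ⊆ H) : IsNormalOn H' U :=
  fun F hF => hH F fun n => h (hF n)

lemma isNormalOn_singleton (hg : DifferentiableOn ℂ g U) : IsNormalOn {g} U := by
  intro F hF
  obtain rfl : F = fun _ => g := funext hF
  exact ⟨id, strictMono_id, Or.inl ⟨g, hg,
    fun u hu z _ => ⟨U, self_mem_nhdsWithin, .of_forall fun _ _ _ => refl_mem_uniformity hu⟩⟩⟩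

lemma IsNormalOn.union (hH : IsNormalOn H U) (hH' : IsNormalOn H' U) : IsNormalOn (H ∪ H') U := by
  intro F hF
  have hfreq : (∃ᶠ n in atTop, F n ∈ H) ∨ ∃ᶠ n in atTop, F n ∈ H' :=
    frequently_or_distrib.1 (Frequently.of_forall hF)
  obtain ⟨ψ, hψ, hFψ⟩ | ⟨ψ, hψ, hFψ⟩ :=
    hfreq.imp extraction_of_frequently_atTop extraction_of_frequently_atTop
  · obtain ⟨φ, hφ, hlim⟩ := hH (F ∘ ψ) hFψ
    exact ⟨ψ ∘ φ, hψ.comp hφ, hlim⟩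
  · obtain ⟨φ, hφ, hlim⟩ := hH' (F ∘ ψ) hFψ
    exact ⟨ψ ∘ φ, hψ.comp hφ, hlim⟩

lemma isNormalOn_of_finite (hS : S.Finite) (hd : ∀ g ∈ S, DifferentiableOn ℂ g U) :
    IsNormalOn S U := by
  induction S, hS using Set.Finite.induction_on with
  | empty => exact fun F hF => (hF 0).elim
  | insert _ _ ih =>
    exact (isNormalOn_singleton (hd _ (mem_insert _ _))).union
      (ih fun g hg => hd g (mem_insert_of_mem _ hg))

lemma exists_isCompact_subset_image_of_isOpenMap {X Y : Type*} [TopologicalSpace X]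
    [LocallyCompactSpace X] [TopologicalSpace Y] {h : X → Y} (hh : IsOpenMap h) {U : Set X}
    (hU : IsOpen U) {K : Set Y} (hK : IsCompact K) (hKU : K ⊆ h '' U) :
    ∃ L ⊆ U, IsCompact L ∧ K ⊆ h '' L := by
  refine hK.induction_on (p := fun K => ∃ L ⊆ U, IsCompact L ∧ K ⊆ h '' L)
    ⟨∅, empty_subset _, isCompact_empty, empty_subset _⟩ ?_ ?_ fun y hy => ?_
  · rintro s t hst ⟨L, hLU, hL, ht⟩
    exact ⟨L, hLU, hL, hst.trans ht⟩
  · rintro s t ⟨L, hLU, hL, hs⟩ ⟨L', hLU', hL', ht⟩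
    exact ⟨L ∪ L', union_subset hLU hLU', hL.union hL',
      image_union h L L' ▸ union_subset_union hs ht⟩
  · obtain ⟨x, hx, rfl⟩ := hKU hy
    obtain ⟨L, hL, hLU, hLc⟩ := local_compact_nhds (hU.mem_nhds hx)
    exact ⟨h '' L, mem_nhdsWithin_of_mem_nhds (hh.image_mem_nhds hL), L, hLU, hLc, Subset.rfl⟩

lemma TendsToInftyLocallyUniformlyOn.image_of_isOpenMap (hh : IsOpenMap h) (hU : IsOpen U)
    (hF : TendsToInftyLocallyUniformlyOn (fun n => F n ∘ h) U) :
    TendsToInftyLocallyUniformlyOn F (h '' U) := by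
  intro K hKU hK M
  obtain ⟨L, hLU, hL, hKL⟩ := exists_isCompact_subset_image_of_isOpenMap hh hU hK hKU
  filter_upwards [hF L hLU hL M] with n hn y hy
  obtain ⟨x, hx, rfl⟩ := hKL hy
  exact hn x hx

lemma exists_tendstoLocallyUniformlyOn_image_of_isOpenMap {X Y E : Type*} [TopologicalSpace X]
    [TopologicalSpace Y] [UniformSpace E] [T2Space E] {F : ℕ → Y → E} {h : X → Y} {g : X → E}
    {U : Set X} (hh : IsOpenMap h) (hU : IsOpen U)
    (hF : TendstoLocallyUniformlyOn (fun n => F n ∘ h) g atTop U) :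
    ∃ k, TendstoLocallyUniformlyOn F k atTop (h '' U) := by
  have hk : ∀ y, ∃ w, ∀ x ∈ U, h x = y → g x = w := by
    intro y
    by_cases hy : y ∈ h '' U
    · obtain ⟨x₀, hx₀, rfl⟩ := hy
      refine ⟨g x₀, fun x hx hxx₀ => tendsto_nhds_unique (hF.tendsto_at hx) ?_⟩
      simpa only [Function.comp_apply, hxx₀] using hF.tendsto_at hx₀
    · exact ⟨F 0 y, fun x hx hxy => (hy ⟨x, hx, hxy⟩).elim⟩
  choose k hk using hk
  refine ⟨k, fun u hu => forall_mem_image.2 fun x hx => ?_⟩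
  obtain ⟨t, ht, hFt⟩ := hF u hu x hx
  rw [hU.nhdsWithin_eq hx] at ht
  refine ⟨h '' (t ∩ U), mem_nhdsWithin_of_mem_nhds
    (hh.image_mem_nhds (inter_mem ht (hU.mem_nhds hx))), hFt.mono fun n hn => ?_⟩
  refine forall_mem_image.2 fun x' hx' => ?_
  rw [← hk _ x' hx'.2 rfl]
  exact hn x' hx'.1

theorem IsNormalOn.boundPropagates (hH : IsNormalOn H U) (hU : IsOpen U) {K L : Set ℂ}
    (hK : IsCompact K) (hKU : K ⊆ U) (hL : IsCompact L) (hLU : L ⊆ U) :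
    BoundPropagates H K L := by
  intro M
  by_contra! hunbounded
  choose F hFH z hz hzM w hw hlt using fun n : ℕ => hunbounded n
  obtain ⟨φ, hφ, ⟨g, hg, hlim⟩ | hlim⟩ := hH F hFH
  · obtain ⟨B, hB⟩ := hL.exists_bound_of_continuousOn (hg.continuousOn.mono hLU)
    have hclose := Metric.tendstoUniformlyOn_iff.1
      ((tendstoLocallyUniformlyOn_iff_forall_isCompact hU).1 hlim L hLU hL) 1 one_pos
    have hlarge : ∀ᶠ n in atTop, B + 1 ≤ φ n :=
      (tendsto_natCast_atTop_atTop.comp hφ.tendsto_atTop).eventually_ge_atTop (B + 1)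
    obtain ⟨n, hclose, hlarge⟩ := (hclose.and hlarge).exists
    have hdist := hclose _ (hw (φ n))
    rw [dist_comm, dist_eq_norm] at hdist
    linarith [norm_le_norm_add_norm_sub' (F (φ n) (w (φ n))) (g (w (φ n))), hB _ (hw (φ n)),
      hlt (φ n)]
  · obtain ⟨n, hn⟩ := (hlim K hKU hK M).exists
    exact (hn _ (hz (φ n))).not_ge (hzM (φ n))

theorem IsNormalOn.image_of_isOpenMap (hh : IsOpenMap h) (hU : IsOpen U)
    (hd : ∀ g ∈ H, DifferentiableOn ℂ g (h '' U)) (hH : IsNormalOn ((· ∘ h) '' H) U) :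
    IsNormalOn H (h '' U) := by
  intro F hF
  obtain ⟨φ, hφ, hlim⟩ := hH (fun n => F n ∘ h) fun n => mem_image_of_mem _ (hF n)
  refine ⟨φ, hφ, hlim.imp ?_ fun hlim => hlim.image_of_isOpenMap hh hU⟩
  rintro ⟨g, -, hg⟩
  obtain ⟨k, hk⟩ := exists_tendstoLocallyUniformlyOn_image_of_isOpenMap hh hU hg
  exact ⟨k, hk.differentiableOn (.of_forall fun n => hd _ (hF _)) (hh U hU), hk⟩

end Normal

section Fatou

variable {f : ℂ → ℂ} {U : Set ℂ} {a b z : ℂ}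

lemma isOpen_fatouSet (f : ℂ → ℂ) : IsOpen (fatouSet f) := by
  refine isOpen_iff_forall_mem_open.2 ?_
  rintro z ⟨U, hU, hUc, hz, hn⟩
  exact ⟨U, fun w hw => ⟨U, hU, hUc, hw, hn⟩, hU, hz⟩

theorem mapsTo_fatouSet_of_isOpenMap (hf : Differentiable ℂ f) (hfo : IsOpenMap f) :
    MapsTo f (fatouSet f) (fatouSet f) := by
  rintro z ⟨U, hU, hUc, hz, hn⟩
  refine ⟨f '' U, hfo U hU, hUc.image f hf.continuous.continuousOn, mem_image_of_mem f hz,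
    IsNormalOn.image_of_isOpenMap hfo hU ?_ (hn.mono ?_)⟩
  · exact forall_mem_range.2 fun n => (hf.iterate n).differentiableOn
  · rintro _ ⟨_, ⟨n, rfl⟩, rfl⟩
    exact ⟨n + 1, Function.iterate_succ f n⟩

theorem mem_fatouSet_of_eventually_mem_holomorphicOmitting (hab : a ≠ b) (hf : Differentiable ℂ f)
    (hU : IsOpen U) (hUc : IsConnected U) (hz : z ∈ U)
    (h : ∀ᶠ n in atTop, f^[n] ∈ holomorphicOmitting U a b) : z ∈ fatouSet f := by
  rw [← Nat.cofinite_eq_atTop] at h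
  have hexcept : IsNormalOn ((fun n => f^[n]) '' {n | f^[n] ∉ holomorphicOmitting U a b}) U :=
    isNormalOn_of_finite (Set.Finite.image _ h)
      (forall_mem_image.2 fun n _ => (hf.iterate n).differentiableOn)
  refine ⟨U, hU, hUc, hz, ((isNormalOn_holomorphicOmitting hab hU hUc).union hexcept).mono ?_⟩
  rintro _ ⟨n, rfl⟩
  exact (em (f^[n] ∈ holomorphicOmitting U a b)).imp id (mem_image_of_mem _)

theorem boundPropagates_iterate_of_subset_fatouSet {D K L : Set ℂ} (hD : IsPreconnected D)
    (hDF : D ⊆ fatouSet f) (hK : IsCompact K) (hKD : K ⊆ D) (hL : IsCompact L) (hLD : L ⊆ D) :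
    BoundPropagates (range fun n => f^[n]) K L := by
  refine BoundPropagates.of_isCompact_of_isPreconnected hD (fun z hz => ?_) hK hKD hL hLD
  obtain ⟨U, hU, -, hzU, hn⟩ := hDF hz
  obtain ⟨V, hV, hVU, hVc⟩ := local_compact_nhds (hU.mem_nhds hzU)
  exact ⟨V, mem_nhdsWithin_of_mem_nhds hV, hn.boundPropagates hU hVc hVU hVc hVU⟩

end Fatou

section Covering

theorem exists_forall_exists_sphere_subset_image_or_norm_le : ∃ C : ℝ, ∀ c, ∀ R > 0, ∀ f : ℂ → ℂ,
    DifferentiableOn ℂ f (ball c R) → ∀ ρ > 0, ‖f c‖ ≤ ρ →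
      (∃ ρ' ≥ ρ, sphere 0 ρ' ⊆ f '' ball c R) ∨ ∀ z ∈ closedBall c (R / 2), ‖f z‖ ≤ C * ρ := by
  obtain ⟨M, hM⟩ := exists_forall_norm_le_of_mem_holomorphicOmitting_ball zero_ne_one 2
  refine ⟨1 + M * 3, fun c R hR f hf ρ hρ hfc => or_iff_not_imp_left.2 fun hsphere z hz => ?_⟩
  push Not at hsphere
  obtain ⟨a, ha, hfa⟩ := not_subset.1 (hsphere ρ le_rfl)
  obtain ⟨b, hb, hfb⟩ := not_subset.1 (hsphere (2 * ρ) (by linarith))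
  rw [mem_sphere_zero_iff_norm] at ha hb
  have hlower : ρ ≤ ‖b - a‖ := by linarith [norm_sub_norm_le b a]
  have hupper : ‖b - a‖ ≤ 3 * ρ := by linarith [norm_sub_le b a]
  have hpos : 0 < ‖b - a‖ := hρ.trans_le hlower
  have homit : f ∈ holomorphicOmitting (ball c R) a b := by
    refine ⟨hf, fun z hz => ?_⟩
    rintro (h | h)
    exacts [hfa ⟨z, hz, h⟩, hfb ⟨z, hz, h⟩]
  have hbound : ‖f z - a‖ ≤ M * ‖b - a‖ := by
    rw [← div_le_iff₀ hpos, ← norm_div]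
    refine hM c R hR _ (sub_div_mem_holomorphicOmitting (ne_of_apply_ne norm ?_) homit) ?_ z hz
    · rw [ha, hb]
      linarith
    · rw [norm_div, div_le_iff₀ hpos]
      linarith [norm_sub_le (f c) a]
  have hM₀ : 0 ≤ M := nonneg_of_mul_nonneg_left ((norm_nonneg _).trans hbound) hpos
  calc ‖f z‖ ≤ ‖a‖ + ‖f z - a‖ := norm_le_norm_add_norm_sub' _ _
    _ ≤ ρ + M * (3 * ρ) := by gcongr; exacts [ha.le, hbound.trans (by gcongr)]
    _ = (1 + M * 3) * ρ := by ring

lemma norm_le_of_forall_mem_sphere_norm_le {E : Type*} [NormedAddCommGroup E] [NormedSpace ℂ E]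
    {f : ℂ → E} {c z : ℂ} {r M : ℝ} (hf : DiffContOnCl ℂ f (ball c r)) (hr : r ≠ 0)
    (h : ∀ z ∈ sphere c r, ‖f z‖ ≤ M) (hz : z ∈ closedBall c r) : ‖f z‖ ≤ M := by
  rw [← frontier_ball c hr] at h
  rw [← closure_ball c hr] at hz
  exact norm_le_of_forall_mem_frontier_norm_le isBounded_ball hf h hz

lemma forall_norm_iterate_le_of_sphere_subset_image {f : ℂ → ℂ} {r M : ℝ}
    (hf : Differentiable ℂ f) (hr : 0 < r)
    (hsphere : ∀ s ≥ r, ∃ ρ ≥ 2 * s, sphere 0 ρ ⊆ f '' ball 0 s)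
    (hM : ∀ n, ∀ z ∈ sphere (0 : ℂ) r, ‖f^[n] z‖ ≤ M) (n : ℕ) (z : ℂ) : ‖f^[n] z‖ ≤ M := by
  have hball : ∀ k n : ℕ, ∀ z ∈ closedBall (0 : ℂ) (2 ^ k * r), ‖f^[n] z‖ ≤ M := by
    intro k
    induction k with
    | zero =>
      intro n z hz
      exact norm_le_of_forall_mem_sphere_norm_le (hf.iterate n).diffContOnCl hr.ne' (hM n)
        (by simpa using hz)
    | succ k ih =>
      intro n z hz
      obtain ⟨ρ, hρ, hsub⟩ := hsphere (2 ^ k * r)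
        (le_mul_of_one_le_left hr.le (one_le_pow₀ one_le_two))
      have hpos : 0 < 2 ^ k * r := by positivity
      refine norm_le_of_forall_mem_sphere_norm_le (hf.iterate n).diffContOnCl (by linarith)
        (fun w hw => ?_) (closedBall_subset_closedBall (by rw [pow_succ]; linarith) hz)
      obtain ⟨x, hx, rfl⟩ := hsub hw
      exact ih (n + 1) x (ball_subset_closedBall hx)
  obtain ⟨k, hk⟩ := pow_unbounded_of_one_lt (‖z‖ / r) one_lt_two
  exact hball k n z (mem_closedBall_zero_iff.2 ((div_lt_iff₀ hr).1 hk).le)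

end Covering

namespace IsTranscendentalEntire

variable {f : ℂ → ℂ} {a b : ℂ}

lemma not_isBounded_range (hf : IsTranscendentalEntire f) : ¬Bornology.IsBounded (range f) :=
  fun h => hf.2 ⟨Polynomial.C (f 0), fun z => by
    rw [Polynomial.eval_C, hf.1.apply_eq_apply_of_bounded h z 0]⟩

theorem isOpenMap (hf : IsTranscendentalEntire f) : IsOpenMap f := by
  refine (AnalyticOnNhd.is_constant_or_isOpenMap fun z _ => hf.1.analyticAt z).resolve_left ?_
  rintro ⟨w, hw⟩
  exact hf.2 ⟨Polynomial.C w, by simpa using hw⟩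

theorem eventually_exists_sphere_subset_image (hf : IsTranscendentalEntire f) :
    ∀ᶠ r in atTop, ∃ ρ ≥ 2 * r, sphere 0 ρ ⊆ f '' ball 0 r := by
  obtain ⟨C, hC⟩ := exists_forall_exists_sphere_subset_image_or_norm_le
  by_contra hfreq
  have hlarge : ∀ᶠ r : ℝ in atTop, 0 < r ∧ ‖f 0‖ ≤ 2 * r :=
    (eventually_gt_atTop 0).and
      ((tendsto_id.const_mul_atTop two_pos).eventually_ge_atTop ‖f 0‖)
  refine hf.2 (exists_polynomial_of_frequently_norm_le (C := 4 * C) (m := 1) hf.1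
    ((tendsto_id.atTop_div_const two_pos).frequently ?_))
  refine ((not_eventually.1 hfreq).and_eventually hlarge).mono fun r ⟨hr, hr₀, hf₀⟩ z hz => ?_
  have hbound := (hC 0 r hr₀ f hf.1.differentiableOn (2 * r) (by positivity) hf₀).resolve_left hr z
    (sphere_subset_closedBall hz)
  rw [id]
  linarith

theorem eventually_exists_lt_norm_iterate (hf : IsTranscendentalEntire f) :
    ∀ᶠ r in atTop, ∀ M, ∃ n, ∃ z ∈ sphere (0 : ℂ) r, M < ‖f^[n] z‖ := by
  filter_upwards [eventually_forall_ge_atTop.2 hf.eventually_exists_sphere_subset_image,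
    eventually_gt_atTop 0] with r hsphere hr M
  by_contra! hM
  refine hf.not_isBounded_range (isBounded_iff_forall_norm_le.2 ⟨M, forall_mem_range.2 ?_⟩)
  exact forall_norm_iterate_le_of_sphere_subset_image hf.1 hr hsphere hM 1

theorem frequently_mem_pair (hf : IsTranscendentalEntire f) (hab : a ≠ b) :
    ∃ᶠ z in Bornology.cobounded ℂ, f z ∈ ({a, b} : Set ℂ) :=
  fun h => hf.2 (exists_polynomial_of_eventually_notMem hab hf.1 h)

end IsTranscendentalEntire

section PeriodicPoints

variable {f : ℂ → ℂ} {a c : ℂ}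

lemma exists_polynomial_of_deriv_eq (hf : Differentiable ℂ f) (h : ∀ z, deriv f z = c) :
    ∃ p : Polynomial ℂ, ∀ z, f z = p.eval z := by
  have hderiv : ∀ z, deriv (fun z => f z - c * z) z = 0 := fun z => by
    rw [deriv_fun_sub (hf z) (by fun_prop), deriv_const_mul_field', deriv_id'', h z]
    ring
  refine ⟨Polynomial.C c * Polynomial.X + Polynomial.C (f 0), fun z => ?_⟩
  have hconst : f z - c * z = f 0 - c * 0 :=
    is_const_of_deriv_eq_zero (f := fun z => f z - c * z) (by fun_prop) hderiv z 0
  simp only [Polynomial.eval_add, Polynomial.eval_mul, Polynomial.eval_C, Polynomial.eval_X]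
  linear_combination hconst

lemma exists_forall_apply_apply_sub_eq (hf : Differentiable ℂ f) (h : ∀ z, f (f z) ≠ z) :
    ∃ c, c ≠ 0 ∧ c ≠ 1 ∧ ∀ z, f (f z) - z = c * (f z - z) := by
  have hfix : ∀ z, f z - z ≠ 0 := fun z hz => h z (by rw [sub_eq_zero.1 hz, sub_eq_zero.1 hz])
  let q : ℂ → ℂ := fun z => (f (f z) - z) / (f z - z)
  have hq₀ : ∀ z, q z ≠ 0 := fun z => div_ne_zero (sub_ne_zero.2 (h z)) (hfix z)
  have hq₁ : ∀ z, q z ≠ 1 := fun z hz =>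
    hfix (f z) (sub_eq_zero.2 (sub_left_injective ((div_eq_one_iff_eq (hfix z)).1 hz)))
  have hq : q ∈ holomorphicOmitting univ 0 1 :=
    ⟨(((hf.comp hf).sub differentiable_id).div (hf.sub differentiable_id) hfix).differentiableOn,
      fun z _ => by simp [hq₀ z, hq₁ z]⟩
  refine ⟨q 0, hq₀ 0, hq₁ 0, fun z => ?_⟩
  rw [eq_of_mem_holomorphicOmitting_univ zero_ne_one hq 0 z, div_mul_cancel₀ _ (hfix z)]

theorem exists_polynomial_of_forall_apply_apply_ne (hf : Differentiable ℂ f)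
    (h : ∀ z, f (f z) ≠ z) : ∃ p : Polynomial ℂ, ∀ z, f z = p.eval z := by
  obtain ⟨c, hc₀, hc₁, hc⟩ := exists_forall_apply_apply_sub_eq hf h
  have hchain : ∀ z, deriv f z * (deriv f (f z) - c) = 1 - c := fun z => by
    have hleft := (hf (f z)).hasDerivAt.comp z (hf z).hasDerivAt
    have hright := (hasDerivAt_id z).add
      (((hf z).hasDerivAt.sub (hasDerivAt_id z)).const_mul c)
    have heq : f ∘ f = id + fun w => c * (f - id : ℂ → ℂ) w :=
      funext fun z => by simpa [sub_eq_iff_eq_add'] using hc z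
    rw [← heq] at hright
    linear_combination hleft.unique hright
  have hne : ∀ z, deriv f z ≠ 0 ∧ deriv f (f z) - c ≠ 0 := fun z =>
    mul_ne_zero_iff.1 (hchain z ▸ sub_ne_zero.2 hc₁.symm)
  have homit : deriv f ∘ f ∈ holomorphicOmitting univ 0 c :=
    ⟨((differentiableOn_univ.1 (hf.differentiableOn.deriv isOpen_univ)).comp hf).differentiableOn,
      fun z _ => by simp [(hne (f z)).1, sub_ne_zero.1 (hne z).2]⟩
  refine exists_polynomial_of_deriv_eq (c := (1 - c) / (deriv f (f 0) - c)) hf fun z => ?_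
  rw [eq_div_iff (hne 0).2, ← hchain z]
  exact congrArg (fun w => deriv f z * (w - c))
    (eq_of_mem_holomorphicOmitting_univ hc₀.symm homit 0 z)

theorem exists_polynomial_of_forall_isFixedPt_eq (hf : Differentiable ℂ f)
    (ha : ∀ z, f z = a → z = a) (hfix : ∀ z, Function.IsFixedPt f z → z = a) :
    ∃ p : Polynomial ℂ, ∀ z, f z = p.eval z := by
  let q : ℂ → ℂ := fun w => (f (a + exp w) - a) / exp w
  have hq : q ∈ holomorphicOmitting univ 0 1 := by
    refine ⟨Differentiable.differentiableOn (by fun_prop (disch := simp)), fun w _ => ?_⟩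
    have h₀ : f (a + exp w) ≠ a := fun h => exp_ne_zero w (by simpa using ha _ h)
    have h₁ : f (a + exp w) ≠ a + exp w := fun h => exp_ne_zero w (by simpa using hfix _ h)
    simp [q, h₀, div_eq_one_iff_eq, sub_eq_iff_eq_add', h₁]
  have hne : ∀ z ∈ ({a}ᶜ : Set ℂ), f z = a + q 0 * (z - a) := fun z hz => by
    have hz' : z - a ≠ 0 := sub_ne_zero.2 hz
    rw [eq_of_mem_holomorphicOmitting_univ zero_ne_one hq 0 (log (z - a))]
    simp only [q, exp_log hz', div_mul_cancel₀ _ hz', add_sub_cancel]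
  have heq : f = fun z => a + q 0 * (z - a) :=
    Continuous.ext_on (dense_compl_singleton a) hf.continuous (by fun_prop) hne
  refine ⟨Polynomial.C a + Polynomial.C (q 0) * (Polynomial.X - Polynomial.C a), fun z => ?_⟩
  simpa using congrFun heq z

end PeriodicPoints

section Orbits

variable {X : Type*} {f : X → X} {x : X}

lemma finite_range_iterate_of_mem_periodicPts (hx : x ∈ Function.periodicPts f) :
    (range fun n => f^[n] x).Finite := by
  obtain ⟨n, hn, hx⟩ := hx
  refine ((finite_Iio n).image fun k => f^[k] x).subset (range_subset_iff.2 fun m => ?_)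
  exact ⟨m % n, Nat.mod_lt m hn, hx.iterate_mod_apply m⟩

lemma finite_setOf_frequently_iterate_eq (f : X → X) (x : X) :
    {y | ∃ᶠ n in atTop, f^[n] x = y}.Finite := by
  obtain h | ⟨y, hy⟩ := {y | ∃ᶠ n in atTop, f^[n] x = y}.eq_empty_or_nonempty
  · exact h ▸ finite_empty
  obtain ⟨n, rfl⟩ := hy.exists
  obtain ⟨m, hm, hnm⟩ := frequently_atTop.1 hy (n + 1)
  have hper : f^[n] x ∈ Function.periodicPts f := by
    refine Function.mk_mem_periodicPts (n := m - n) (by lia) ?_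
    rw [Function.IsPeriodicPt, Function.IsFixedPt, ← Function.iterate_add_apply,
      Nat.sub_add_cancel (by lia), hnm]
  refine (finite_range_iterate_of_mem_periodicPts hper).subset fun z hz => ?_
  obtain ⟨k, hk, rfl⟩ := frequently_atTop.1 hz n
  exact ⟨k - n, by simp only [← Function.iterate_add_apply, Nat.sub_add_cancel hk]⟩

end Orbits

namespace IsTranscendentalEntire

variable {f : ℂ → ℂ} {U : Set ℂ} {a b z p : ℂ}

lemma mapsTo_fatouSet (hf : IsTranscendentalEntire f) : MapsTo f (fatouSet f) (fatouSet f) :=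
  mapsTo_fatouSet_of_isOpenMap hf.1 hf.isOpenMap

lemma mem_juliaSet_of_apply_mem (hf : IsTranscendentalEntire f) (hz : f z ∈ juliaSet f) :
    z ∈ juliaSet f :=
  fun hzF => hz (hf.mapsTo_fatouSet hzF)

theorem mem_juliaSet_of_isBounded_orbit (hf : IsTranscendentalEntire f)
    (hfin : (juliaSet f).Finite) (hp : Bornology.IsBounded (range fun n => f^[n] p)) :
    p ∈ juliaSet f := by
  intro hpF
  have hconn : IsPreconnected (fatouSet f) := by
    rw [← compl_compl (fatouSet f)]
    exact (hfin.countable.isPathConnected_compl_of_one_lt_rank (by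
      rw [rank_real_complex]; exact Nat.one_lt_ofNat)).isConnected.isPreconnected
  obtain ⟨M, hM⟩ := isBounded_iff_forall_norm_le.1 hp
  obtain ⟨R, hR⟩ := hfin.isBounded.subset_ball 0
  obtain ⟨r, hunbounded, hr⟩ :=
    (hf.eventually_exists_lt_norm_iterate.and (eventually_ge_atTop R)).exists
  have hsphere : sphere 0 r ⊆ fatouSet f := fun z hz => by
    by_contra hzJ
    exact ((mem_ball_zero_iff.1 (hR hzJ)).trans_le hr).ne (mem_sphere_zero_iff_norm.1 hz)
  obtain ⟨M', hM'⟩ := boundPropagates_iterate_of_subset_fatouSet hconn Subset.rfl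
    isCompact_singleton (singleton_subset_iff.2 hpF) (isCompact_sphere 0 r) hsphere M
  obtain ⟨n, z, hz, hlt⟩ := hunbounded M'
  exact hlt.not_ge (hM' _ ⟨n, rfl⟩ p rfl (hM _ ⟨n, rfl⟩) z hz)

lemma periodicPts_subset_juliaSet (hf : IsTranscendentalEntire f) (hfin : (juliaSet f).Finite) :
    Function.periodicPts f ⊆ juliaSet f :=
  fun _ hp => hf.mem_juliaSet_of_isBounded_orbit hfin
    (finite_range_iterate_of_mem_periodicPts hp).isBounded

lemma exists_apply_apply_eq (hf : IsTranscendentalEntire f) : ∃ z, f (f z) = z := by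
  by_contra! h
  exact hf.2 (exists_polynomial_of_forall_apply_apply_ne hf.1 h)

lemma exists_isFixedPt_ne (hf : IsTranscendentalEntire f) (ha : ∀ z, f z = a → z = a) :
    ∃ z, Function.IsFixedPt f z ∧ z ≠ a := by
  by_contra! h
  exact hf.2 (exists_polynomial_of_forall_isFixedPt_eq hf.1 ha h)

theorem infinite_juliaSet (hf : IsTranscendentalEntire f) : (juliaSet f).Infinite := by
  intro hfin
  have hper := hf.periodicPts_subset_juliaSet hfin
  obtain ⟨a, ha⟩ : (juliaSet f).Nonempty :=
    hf.exists_apply_apply_eq.imp fun z hz => hper (Function.mk_mem_periodicPts two_pos hz)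
  obtain hsub | ⟨a, ha, b, hb, hab⟩ := (juliaSet f).subsingleton_or_nontrivial
  · obtain ⟨z, hz, hza⟩ := hf.exists_isFixedPt_ne (a := a) fun z hz =>
      hsub (hf.mem_juliaSet_of_apply_mem (hz ▸ ha)) ha
    exact hza (hsub (hper (Function.mk_mem_periodicPts one_pos hz)) ha)
  · obtain ⟨z, hz, hzJ⟩ := ((hf.frequently_mem_pair hab).and_eventually
      (Bornology.isBounded_def.1 hfin.isBounded)).exists
    exact hzJ (hf.mem_juliaSet_of_apply_mem (pair_subset ha hb hz))

lemma iterate_mem_holomorphicOmitting (hf : IsTranscendentalEntire f) (hU : U \ {p} ⊆ fatouSet f)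
    (ha : a ∈ juliaSet f) (hb : b ∈ juliaSet f) {n : ℕ} (hp : f^[n] p ∉ ({a, b} : Set ℂ)) :
    f^[n] ∈ holomorphicOmitting U a b := by
  refine ⟨(hf.1.iterate n).differentiableOn, fun z hz => ?_⟩
  obtain rfl | hzp := eq_or_ne z p
  · exact hp
  · exact fun hmem => pair_subset ha hb hmem (hf.mapsTo_fatouSet.iterate n (hU ⟨hz, hzp⟩))

theorem accPt_juliaSet (hf : IsTranscendentalEntire f) (hp : p ∈ juliaSet f) :
    AccPt p (𝓟 (juliaSet f)) := by
  rw [accPt_iff_frequently_nhdsNE]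
  intro hisolated
  obtain ⟨R, hR, hball⟩ := Metric.nhdsWithin_basis_ball.eventually_iff.1 hisolated
  obtain ⟨a, ⟨ha, hpa⟩, b, ⟨hb, hpb⟩, hab⟩ :=
    (hf.infinite_juliaSet.sdiff (finite_setOf_frequently_iterate_eq f p)).nontrivial
  refine hp (mem_fatouSet_of_eventually_mem_holomorphicOmitting hab hf.1 isOpen_ball
    ((convex_ball p R).isConnected ⟨p, mem_ball_self hR⟩) (mem_ball_self hR) ?_)
  filter_upwards [not_frequently.1 hpa, not_frequently.1 hpb] with n hna hnb
  exact hf.iterate_mem_holomorphicOmitting (fun z hz => not_not.1 (hball hz)) ha hb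
    (by rintro (h | h); exacts [hna h, hnb h])

end IsTranscendentalEntire

theorem mainTheorem2 (f : ℂ → ℂ) (hf : IsTranscendentalEntire f) :
    (juliaSet f).Infinite ∧ Perfect (juliaSet f) :=
  ⟨hf.infinite_juliaSet, (isOpen_fatouSet f).isClosed_compl, fun _ => hf.accPt_juliaSet⟩
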